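/- Let $\mathbb F=\mathbb R$ or $\mathbb C$ and write $[m]=\{1,\dots,m\}$. Definitions. A symmetric $(m,l,\lambda)$ block design is a set $\mathbb S$ of exactly $m$ subsets of $[m]$ (blocks), each of size $l$, such that every two-element subset of $[m]$ lies in exactly $\lambda$ blocks and all elements of $[m]$ lie in the same number of blocks; its complement is $\mathbb S^c=\{[m]\setminus\mathcal J:\mathcal J\in\mathbb S\}$. Orthonormal bases $\mathcal B_k=\{b^{(k)}_j\}_{j=1}^m$ $(k\in K)$ of $\mathbb F^m$ are mutually unbiased bases (MUBs) if $|\langle b^{(k)}_j,b^{(k')}_{j'}\rangle|^2=\frac1m$ for all $k\ne k'$ and all $j,j'$; a set of MUBs is called maximal if $|K|=m/2+1$ (for $\mathbb F=\mathbb R$), respectively $|K|=m+1$ (for $\mathbb F=\mathbb C$). For $\mathcal J\subset[m]$ put $P^{\mathcal B_k}_{\mathcal J}=\sum_{j\in\mathcal J}b^{(k)}_j(b^{(k)}_j)^*$. A packing for $\mathbb F^m$ is a finite family $\mathcal P=\{P_i\}_{i\in I}$ of non-zero orthogonal projections on $\mathbb F^m$; its mixture is the number of different ranks of the $P_i$,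 and it is mixed-rank if its mixture is not $1$. It is tight if $\sum_i P_i$ is a positive multiple of the identity $I_m$. For $0<l<m$ let $\mathcal K_l$ be the set of the matrices $\sqrt{\frac{m}{l(m-l)}}\,\bigl(P-\frac lm I_m\bigr)$ with $P$ an orthogonal projection of rank $l$ on $\mathbb F^m$; these are unit vectors of the real space of traceless self-adjoint $m\times m$ matrices over $\mathbb F$ with the inner product $\langle A,B\rangle=\operatorname{tr}(AB)$. The embedded vector of a projection $P_i$ of rank $l_i$, $0<l_i<m$, is $v_i=\sqrt{\frac{m}{l_i(m-l_i)}}\,\bigl(P_i-\frac{l_i}m I_m\bigr)\in\mathcal K_{l_i}$. A packing all of whose ranks $l_i$ satisfy $0<l_i<m$ is optimally spread if $$\max_{i\ne j}\langle v_i,v_j\rangle=\min_{(u_i)\in\prod_i\mathcal K_{l_i}}\ \max_{i\ne j}\langle u_i,u_j\rangle .$$ Statement. (1) Let $m=4^a$ with $a\ge1$. Then there is a maximal set of MUBs in $\mathbb R^m$, and for every maximal set of MUBs $\{\mathcal B_k\}_{k=1}^{m/2+1}$ in $\mathbb R^m$, every symmetric block design $\mathbb S$ on $[m]$ and every partition $\{A_1,A_2\}$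 of $[m/2+1]$ into two non-empty sets, the family $$\{P^{\mathcal B_k}_{\mathcal J}:k\in A_1,\ \mathcal J\in\mathbb S\}\cup\{P^{\mathcal B_k}_{\mathcal J}:k\in A_2,\ \mathcal J\in\mathbb S^c\}$$ is a tight optimally spread mixed-rank packing with a mixture of $2$ for $\mathbb R^m$. (2) Let $m$ be a prime power. Then there is a maximal set of MUBs in $\mathbb C^m$. If $m\neq2$, then for every maximal set of MUBs $\{\mathcal B_k\}_{k=1}^{m+1}$ in $\mathbb C^m$, every symmetric block design $\mathbb S$ on $[m]$ and every partition $\{A_1,A_2\}$ of $[m+1]$ into two non-empty sets, the family $$\{P^{\mathcal B_k}_{\mathcal J}:k\in A_1,\ \mathcal J\in\mathbb S\}\cup\{P^{\mathcal B_k}_{\mathcal J}:k\in A_2,\ \mathcal J\in\mathbb S^c\}$$ is a tight optimally spread mixed-rank packing with a mixture of $2$ for $\mathbb C^m$. -/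

import Mathlib

noncomputable section

namespace MixedPacking

open Matrix
open scoped ComplexOrder

/-! ### Packings, mixture, tight fusion frames -/

/-- The Grassmannian `G(l, 𝕜^m)`: the orthogonal projections of rank `l` on `𝕜^m`, as matrices. -/
def Grassmannian (𝕜 : Type*) [RCLike 𝕜] (m l : ℕ) : Set (Matrix (Fin m) (Fin m) 𝕜) :=
  {P | IsStarProjection P ∧ P.rank = l}

/-- A packing for `𝕜^m`: a finite family of orthogonal projections of rank between `1` and `m`. -/
def IsPacking {𝕜 : Type*} [RCLike 𝕜] {m : ℕ} {ι : Type*}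
    (P : ι → Matrix (Fin m) (Fin m) 𝕜) : Prop :=
  ∀ i, IsStarProjection (P i) ∧ 1 ≤ (P i).rank ∧ (P i).rank ≤ m

/-- The mixture of a packing: the number of different ranks among its elements. -/
def mixture {𝕜 : Type*} [RCLike 𝕜] {m : ℕ} {ι : Type*} [Fintype ι]
    (P : ι → Matrix (Fin m) (Fin m) 𝕜) : ℕ :=
  (Finset.univ.image fun i => (P i).rank).card

/-- A packing is a tight fusion frame if its fusion frame operator `∑ i, P i` is positive definite
and a multiple of the identity. -/
def IsTightFusionFrame {𝕜 : Type*} [RCLike 𝕜] {m : ℕ} {ι : Type*} [Fintype ι]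
    (P : ι → Matrix (Fin m) (Fin m) 𝕜) : Prop :=
  (∑ i, P i).PosDef ∧ ∃ c : 𝕜, ∑ i, P i = c • (1 : Matrix (Fin m) (Fin m) 𝕜)

/-! ### The embedding into the unit sphere of the traceless Hermitian matrices -/

/-- The Hilbert-Schmidt inner product. On the real vector space of Hermitian matrices
it is `tr (A B)`. -/
def hsInner {𝕜 : Type*} [RCLike 𝕜] {m : ℕ} (A B : Matrix (Fin m) (Fin m) 𝕜) : ℝ :=
  RCLike.re (Aᴴ * B).trace

/-- The radius `r_l = √(l (m - l) / m)`. -/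
def radius (m l : ℕ) : ℝ :=
  Real.sqrt ((l : ℝ) * ((m : ℝ) - (l : ℝ)) / (m : ℝ))

/-- The normalized traceless map `P ↦ (P - (l / m) I) / r_l`, for `P` of rank `l`, `0 < l < m`.
Its values are unit vectors of the Euclidean space of traceless Hermitian matrices. -/
def embed {𝕜 : Type*} [RCLike 𝕜] {m : ℕ} (l : ℕ) (P : Matrix (Fin m) (Fin m) 𝕜) :
    Matrix (Fin m) (Fin m) 𝕜 :=
  (((radius m l)⁻¹ : ℝ) : 𝕜) • (P - ((l : 𝕜) / (m : 𝕜)) • (1 : Matrix (Fin m) (Fin m) 𝕜))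

/-- The image `K_l` of the Grassmannian `G(l, 𝕜^m)` in the unit sphere. -/
def embeddedGrassmannian (𝕜 : Type*) [RCLike 𝕜] (m l : ℕ) : Set (Matrix (Fin m) (Fin m) 𝕜) :=
  embed l '' Grassmannian 𝕜 m l

/-- The inner products of the pairs of elements of a family with different indices. -/
def pairInners {𝕜 : Type*} [RCLike 𝕜] {m : ℕ} {ι : Type*}
    (u : ι → Matrix (Fin m) (Fin m) 𝕜) : Set ℝ :=
  {x | ∃ i j, i ≠ j ∧ hsInner (u i) (u j) = x}

/-- A packing is optimally spread if its elements have embedded vectors (ranks strictly between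
`0` and `m`) and the maximal inner product of these vectors is the least one among all families
with the same index set and with `u i` in `K_l`, `l` the rank of `P i`. -/
def IsOptimallySpread {𝕜 : Type*} [RCLike 𝕜] {m : ℕ} {ι : Type*}
    (P : ι → Matrix (Fin m) (Fin m) 𝕜) : Prop :=
  (∀ i, 0 < (P i).rank ∧ (P i).rank < m) ∧
  ∃ μ : ℝ, IsGreatest (pairInners fun i => embed (P i).rank (P i)) μ ∧
    IsLeast {ν : ℝ | ∃ u : ι → Matrix (Fin m) (Fin m) 𝕜,
      (∀ i, u i ∈ embeddedGrassmannian 𝕜 m (P i).rank) ∧ IsGreatest (pairInners u) ν} μ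

/-! ### Mutually unbiased bases and coordinate projections -/

/-- A family of orthonormal bases of `𝕜^m` is mutually unbiased. -/
def IsMUB {𝕜 : Type*} [RCLike 𝕜] {m : ℕ} {κ : Type*}
    (B : κ → OrthonormalBasis (Fin m) 𝕜 (EuclideanSpace 𝕜 (Fin m))) : Prop :=
  ∀ k k', k ≠ k' → ∀ j j', ‖inner 𝕜 (B k j) (B k' j')‖ ^ 2 = 1 / (m : ℝ)

/-- The coordinate projection `∑ j ∈ J, b_j b_j^*`. -/
def coordProj {𝕜 : Type*} [RCLike 𝕜] {m : ℕ}
    (b : OrthonormalBasis (Fin m) 𝕜 (EuclideanSpace 𝕜 (Fin m))) (J : Finset (Fin m)) :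
    Matrix (Fin m) (Fin m) 𝕜 :=
  ∑ j ∈ J, vecMulVec (fun i => b j i) (fun i => star (b j i))

/-! ### Block designs -/

/-- `S` is a `t`-`(m, l, lam)` block design on the points `Fin m`. -/
def IsBlockDesign {m : ℕ} (t l lam : ℕ) (S : Finset (Finset (Fin m))) : Prop :=
  (∀ J ∈ S, J.card = l) ∧
  (∀ T : Finset (Fin m), T.card = t → (S.filter fun J => T ⊆ J).card = lam) ∧
  ∃ r : ℕ, ∀ x : Fin m, (S.filter fun J => x ∈ J).card = r

/-- `S` is a symmetric `(m, l, lam)` block design: a `2`-design with as many blocks as points. -/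
def IsSymmetricDesign {m : ℕ} (l lam : ℕ) (S : Finset (Finset (Fin m))) : Prop :=
  IsBlockDesign 2 l lam S ∧ S.card = m

/-- The complement of a design: its blocks are the complements of the blocks of `S`. -/
def complDesign {m : ℕ} (S : Finset (Finset (Fin m))) : Finset (Finset (Fin m)) :=
  S.image fun J => Jᶜ

/-- `{A₁, A₂}` is a partition of the finite type `κ` into two parts. -/
def IsTwoPartition {κ : Type*} [Fintype κ] [DecidableEq κ] (A₁ A₂ : Finset κ) : Prop :=
  A₁.Nonempty ∧ A₂.Nonempty ∧ Disjoint A₁ A₂ ∧ A₁ ∪ A₂ = Finset.univ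

/-- The union of `{P_J^{B_k} : k ∈ A₁, J ∈ S₁}` and `{P_J^{B_k} : k ∈ A₂, J ∈ S₂}`, as a family. -/
def unionFamily {𝕜 : Type*} [RCLike 𝕜] {m : ℕ} {κ : Type*}
    (B : κ → OrthonormalBasis (Fin m) 𝕜 (EuclideanSpace 𝕜 (Fin m)))
    (A₁ A₂ : Finset κ) (S₁ S₂ : Finset (Finset (Fin m))) :
    (A₁ × S₁) ⊕ (A₂ × S₂) → Matrix (Fin m) (Fin m) 𝕜 :=
  Sum.elim (fun p => coordProj (B p.1) p.2) (fun p => coordProj (B p.1) p.2)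

/-- `P` is a tight optimally spread mixed-rank packing with a mixture of `s` (`s ≠ 1`). -/
def IsTightOptimalMixedPacking {𝕜 : Type*} [RCLike 𝕜] {m : ℕ} {ι : Type*} [Fintype ι]
    (P : ι → Matrix (Fin m) (Fin m) 𝕜) (s : ℕ) : Prop :=
  IsPacking P ∧ IsTightFusionFrame P ∧ IsOptimallySpread P ∧ mixture P = s ∧ s ≠ 1

end MixedPacking

end

-- Optimality comes from a counting bound: at most `d + 1` vectors of a `d`-dimensional Euclidean
-- space have pairwise negative inner products (`card_le_of_obtuse`). So a larger family of
-- Hermitian matrices has maximal inner product at least `0`, and a packing whose embedded vectors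
-- attain `0` is optimally spread (`isOptimallySpread_of_card`). The dimension of all Hermitian
-- matrices, traceless or not, can serve as `d`, because the family exceeds it by `m / 2` (real) or
-- `m` (complex) elements.
--
-- The inner product of two embedded projections `P`, `Q` of ranks `l`, `l'` has the sign of `tr (P
-- Q) - l l' / m`. It is zero for different unbiased bases. Within one basis two blocks meet in
-- `lam` points, and `lam * m ≤ l ^ 2` follows from `l ^ 2 = l + (m - 1) * lam`; complements inherit
-- the inequality. Each basis contributes a multiple of the identity, whence tightness, and `l ≠ m -
-- l` as soon as `2 < m`.
--
-- Maximal sets of MUBs live on functions on a group `V` of order `m`. Besides the standard basis,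
-- each `s` gives the vectors `x ↦ χ s x * e (D y x) / √m`, where `χ s` is quadratic with polar form
-- `β s`. Nondegenerate differences `β s - β t` make the relevant exponential sums have modulus `√m`
-- (`exists_isMUB_of_refinement`). The complex case uses the forms `Tr (s x y)` on a finite field,
-- the real case a Kerdock set of alternating forms.

noncomputable section

namespace MixedPacking

open Matrix
open scoped ComplexOrder

/-! ### Families with pairwise negative inner products -/

section Obtuse

variable {E ι : Type*} [AddCommGroup E] [Module ℝ E] [Fintype ι] {β : LinearMap.BilinForm ℝ E}
  {v : ι → E} {w : E}

/-- If two nonnegative combinations of an obtuse family with disjoint supports agree, and all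
members of the family make an obtuse angle with `w`, then the coefficients vanish. -/
lemma coeff_eq_zero_of_obtuse (hpos : ∀ x, x ≠ 0 → 0 < β x x)
    (hneg : ∀ i j, i ≠ j → β (v i) (v j) < 0) (hw : ∀ i, β (v i) w < 0)
    {a b : ι → ℝ} (ha : ∀ i, 0 ≤ a i) (hb : ∀ i, 0 ≤ b i) (hab : ∀ i, a i * b i = 0)
    (h : ∑ i, a i • v i = ∑ i, b i • v i) (i : ι) : a i = 0 := by
  -- Pairing the two expressions of this vector with each other leaves only off-diagonal terms, all
  -- nonpositive, so its square is nonpositive.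
  have hx : ∑ i, a i • v i = 0 := by
    by_contra hne
    have h1 := hpos _ hne
    have h2 : β (∑ i, a i • v i) (∑ i, b i • v i) ≤ 0 := by
      simp only [map_sum, LinearMap.sum_apply, map_smul, LinearMap.smul_apply, smul_eq_mul]
      simp only [Finset.mul_sum]
      refine Finset.sum_nonpos fun i _ => Finset.sum_nonpos fun j _ => ?_
      by_cases hij : j = i
      · subst hij
        rw [← mul_assoc, mul_comm (b j), hab, zero_mul]
      · exact mul_nonpos_of_nonneg_of_nonpos (hb _)
          (mul_nonpos_of_nonneg_of_nonpos (ha _) (hneg _ _ hij).le)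
    rw [← h] at h2
    exact absurd h1 (not_lt.2 h2)
  have h3 : ∑ i, a i * β (v i) w = 0 := by
    have := congrArg (fun y => β y w) hx
    simpa using this
  have h4 := (Finset.sum_eq_zero_iff_of_nonpos
    (fun i _ => mul_nonpos_of_nonneg_of_nonpos (ha i) (hw i).le)).1 h3 i (Finset.mem_univ i)
  exact (mul_eq_zero.1 h4).resolve_right (hw i).ne

/-- A family with pairwise negative inner products, all in the open half space opposite to some
vector, is linearly independent. -/
lemma linearIndependent_of_obtuse (hpos : ∀ x, x ≠ 0 → 0 < β x x)
    (hneg : ∀ i j, i ≠ j → β (v i) (v j) < 0) (hw : ∀ i, β (v i) w < 0) :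
    LinearIndependent ℝ v := by
  rw [Fintype.linearIndependent_iff]
  intro g hg i
  -- A linear relation is an equality of two nonnegative combinations with disjoint supports.
  have hsplit : ∑ i, (g i)⁺ • v i = ∑ i, (g i)⁻ • v i := by
    rw [← sub_eq_zero, ← Finset.sum_sub_distrib, ← hg]
    exact Finset.sum_congr rfl fun j _ => by rw [← sub_smul, posPart_sub_negPart]
  have hmul : ∀ j, (g j)⁺ * (g j)⁻ = 0 := fun j => by
    rcases le_total 0 (g j) with h | h
    · rw [negPart_eq_zero.2 h, mul_zero]
    · rw [posPart_eq_zero.2 h, zero_mul]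
  have h1 := coeff_eq_zero_of_obtuse hpos hneg hw (fun j => posPart_nonneg _)
    (fun j => negPart_nonneg _) hmul hsplit i
  have h2 := coeff_eq_zero_of_obtuse hpos hneg hw (fun j => negPart_nonneg _)
    (fun j => posPart_nonneg _) (fun j => by rw [mul_comm, hmul]) hsplit.symm i
  rw [← posPart_sub_negPart (g i), h1, h2, sub_zero]

/-- At most `d + 1` vectors of a `d`-dimensional Euclidean space have pairwise negative inner
products. -/
lemma card_le_of_obtuse {F : Type*} [AddCommGroup F] [Module ℝ F] [FiniteDimensional ℝ F]
    (f : F →ₗ[ℝ] E) (hpos : ∀ x, x ≠ 0 → 0 < β x x)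
    (hneg : ∀ i j, i ≠ j → β (v i) (v j) < 0) (hv : ∀ i, v i ∈ LinearMap.range f) :
    Fintype.card ι ≤ Module.finrank ℝ F + 1 := by
  classical
  rcases isEmpty_or_nonempty ι with h | ⟨⟨i₀⟩⟩
  · simp
  choose u hu using hv
  -- One vector is set aside to play the role of `w`; this accounts for the `+ 1`.
  have hli : LinearIndependent ℝ (fun i : {i // i ≠ i₀} => v i) :=
    linearIndependent_of_obtuse (w := v i₀) hpos
      (fun i j hij => hneg _ _ fun h => hij (Subtype.ext h)) (fun i => hneg _ _ i.2)
  have hli' : LinearIndependent ℝ (fun i : {i // i ≠ i₀} => u i) := by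
    refine LinearIndependent.of_comp f ?_
    simpa [Function.comp_def, hu] using hli
  have := hli'.fintype_card_le_finrank
  rw [Fintype.card_subtype_compl, Fintype.card_subtype_eq] at this
  lia

end Obtuse

-- The space of Hermitian matrices and its dimension

section Hermitian

variable {𝕜 : Type*} [RCLike 𝕜] {m : ℕ}

/-- The Hilbert-Schmidt inner product as a real bilinear form. -/
def hsForm (𝕜 : Type*) [RCLike 𝕜] (m : ℕ) : LinearMap.BilinForm ℝ (Matrix (Fin m) (Fin m) 𝕜) :=
  LinearMap.mk₂ ℝ hsInner
    (fun A B C => by simp [hsInner, add_mul])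
    (fun c A B => by simp [hsInner, RCLike.smul_re])
    (fun A B C => by simp [hsInner, mul_add])
    (fun c A B => by simp [hsInner, RCLike.smul_re])

lemma hsInner_self_pos (A : Matrix (Fin m) (Fin m) 𝕜) (hA : A ≠ 0) : 0 < hsInner A A := by
  have h := (Matrix.posSemidef_conjTranspose_mul_self A).trace_nonneg
  refine lt_of_le_of_ne (RCLike.nonneg_iff.1 h).1 fun h0 => hA ?_
  rw [← Matrix.trace_conjTranspose_mul_self_eq_zero_iff]
  exact RCLike.ext (by simpa [hsInner] using h0.symm) (by simpa using (RCLike.nonneg_iff.1 h).2)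

/-- The symmetric matrix with given entries on the unordered pairs of indices. -/
def symmetricOf (m : ℕ) : (Sym2 (Fin m) → ℝ) →ₗ[ℝ] Matrix (Fin m) (Fin m) ℝ where
  toFun f := Matrix.of fun i j => f s(i, j)
  map_add' _ _ := rfl
  map_smul' _ _ := rfl

/-- Bounds the dimension of the real symmetric matrices by the number of unordered pairs;
injectivity of the parametrization plays no role. -/
lemma mem_range_symmetricOf {A : Matrix (Fin m) (Fin m) ℝ} (hA : A.IsHermitian) :
    A ∈ LinearMap.range (symmetricOf m) := by
  refine ⟨Sym2.lift ⟨fun i j => A i j, fun i j => ?_⟩, rfl⟩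
  simpa using (hA.apply i j).symm

/-- The Hermitian matrix with the real parts of its entries on and above the diagonal and their
imaginary parts below it given. -/
def hermitianOf (m : ℕ) : (Fin m × Fin m → ℝ) →ₗ[ℝ] Matrix (Fin m) (Fin m) ℂ where
  toFun f := Matrix.of fun i j => if i = j then (f (i, i) : ℂ) else
    if i < j then ⟨f (i, j), f (j, i)⟩ else ⟨f (j, i), -f (i, j)⟩
  map_add' f g := by
    ext i j
    simp only [of_apply, Matrix.add_apply, Pi.add_apply]
    split_ifs <;> apply Complex.ext <;> simp [add_comm]
  map_smul' c f := by
    ext i j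
    simp only [of_apply, Matrix.smul_apply, Pi.smul_apply]
    split_ifs <;> apply Complex.ext <;> simp

lemma mem_range_hermitianOf {A : Matrix (Fin m) (Fin m) ℂ} (hA : A.IsHermitian) :
    A ∈ LinearMap.range (hermitianOf m) := by
  refine ⟨fun p => if p.1 ≤ p.2 then (A p.1 p.2).re else (A p.2 p.1).im, ?_⟩
  ext i j
  simp only [hermitianOf, LinearMap.coe_mk, AddHom.coe_mk, of_apply]
  split_ifs with h1 h2 h3 h4 h5 h6 <;> try (exfalso; lia)
  · subst h1
    exact hA.coe_re_apply_self i
  · rfl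
  · rw [← hA.apply i j]
    rfl

lemma embed_isHermitian {l : ℕ} {A : Matrix (Fin m) (Fin m) 𝕜}
    (hA : A ∈ embeddedGrassmannian 𝕜 m l) : A.IsHermitian := by
  obtain ⟨P, hP, rfl⟩ := hA
  have h : Pᴴ = P := hP.1.isSelfAdjoint
  simp [embed, Matrix.IsHermitian, h]

end Hermitian

/-- `d + 2` or more vectors do not have pairwise negative inner products, so a packing with
nonpositive inner products, one of them zero, is optimally spread. -/
lemma isOptimallySpread_of_card {𝕜 : Type*} [RCLike 𝕜] {m : ℕ} {ι : Type*} [Fintype ι]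
    {F : Type*} [AddCommGroup F] [Module ℝ F] [FiniteDimensional ℝ F]
    (f : F →ₗ[ℝ] Matrix (Fin m) (Fin m) 𝕜)
    (hf : ∀ A : Matrix (Fin m) (Fin m) 𝕜, A.IsHermitian → A ∈ LinearMap.range f)
    (hcard : Module.finrank ℝ F + 1 < Fintype.card ι)
    (P : ι → Matrix (Fin m) (Fin m) 𝕜) (hP : ∀ i, IsStarProjection (P i))
    (hrank : ∀ i, 0 < (P i).rank ∧ (P i).rank < m)
    (hle : ∀ i j, i ≠ j → hsInner (embed (P i).rank (P i)) (embed (P j).rank (P j)) ≤ 0)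
    (heq : ∃ i j, i ≠ j ∧ hsInner (embed (P i).rank (P i)) (embed (P j).rank (P j)) = 0) :
    IsOptimallySpread P := by
  have hgr : IsGreatest (pairInners fun i => embed (P i).rank (P i)) 0 := by
    refine ⟨heq, ?_⟩
    rintro x ⟨i, j, hij, rfl⟩
    exact hle i j hij
  refine ⟨hrank, 0, hgr, ⟨_, fun i => ⟨P i, ⟨hP i, rfl⟩, rfl⟩, hgr⟩, ?_⟩
  rintro ν ⟨u, hu, hν⟩
  by_contra! hlt
  refine hcard.not_ge (card_le_of_obtuse (β := hsForm 𝕜 m) (v := u) f hsInner_self_pos ?_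
    fun i => hf _ (embed_isHermitian (hu i)))
  exact fun i j hij => (hν.2 ⟨i, j, hij, rfl⟩).trans_lt hlt

/-! ### Symmetric designs -/

section Design

variable {m l lam r : ℕ} {S : Finset (Finset (Fin m))}

lemma sum_card_inter (hr : ∀ x : Fin m, (S.filter fun J => x ∈ J).card = r)
    (B : Finset (Fin m)) : ∑ J ∈ S, (B ∩ J).card = B.card * r := by
  have h : ∀ J ∈ S, (B ∩ J).card = ∑ x ∈ B, if x ∈ J then 1 else 0 := fun J _ => by
    rw [← Finset.card_filter, Finset.filter_mem_eq_inter]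
  rw [Finset.sum_congr rfl h, Finset.sum_comm]
  simp only [← Finset.card_filter, hr, Finset.sum_const, smul_eq_mul]

/-- Double counting of the triples `(x, y, J)` with `x, y ∈ B ∩ J`: a pair with `x = y` lies in `r`
blocks, any other in `lam`. -/
lemma sum_card_inter_sq (hr : ∀ x : Fin m, (S.filter fun J => x ∈ J).card = r)
    (hlam : ∀ T : Finset (Fin m), T.card = 2 → (S.filter fun J => T ⊆ J).card = lam)
    (B : Finset (Fin m)) :
    ∑ J ∈ S, (B ∩ J).card ^ 2 = B.card * (r + (B.card - 1) * lam) := by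
  have h : ∀ J ∈ S, (B ∩ J).card ^ 2 =
      ∑ x ∈ B, ∑ y ∈ B, if x ∈ J ∧ y ∈ J then 1 else 0 := fun J _ => by
    have : (B ∩ J).card = ∑ x ∈ B, if x ∈ J then 1 else 0 := by
      rw [← Finset.card_filter, Finset.filter_mem_eq_inter]
    rw [this, sq, Finset.sum_mul_sum]
    refine Finset.sum_congr rfl fun x _ => Finset.sum_congr rfl fun y _ => ?_
    by_cases hx : x ∈ J <;> by_cases hy : y ∈ J <;> simp [hx, hy]
  rw [Finset.sum_congr rfl h, Finset.sum_comm]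
  rw [← smul_eq_mul, ← Finset.sum_const]
  refine Finset.sum_congr rfl fun x hx => ?_
  rw [Finset.sum_comm, ← Finset.add_sum_erase _ _ hx]
  congr 1
  · simp only [and_self, ← Finset.card_filter, hr]
  · rw [← Finset.card_erase_of_mem hx, ← smul_eq_mul, ← Finset.sum_const]
    refine Finset.sum_congr rfl fun y hy => ?_
    rw [← Finset.card_filter, ← hlam {x, y} (Finset.card_pair (Finset.ne_of_mem_erase hy).symm)]
    congr 1
    ext J
    simp [Finset.insert_subset_iff]

namespace IsSymmetricDesign

/-- Every point of a symmetric design lies in `l` blocks. -/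
lemma card_filter_mem (h : IsSymmetricDesign l lam S) (x : Fin m) :
    (S.filter fun J => x ∈ J).card = l := by
  obtain ⟨⟨hl, -, r, hr⟩, hS⟩ := h
  have h1 := sum_card_inter hr Finset.univ
  rw [Finset.sum_congr rfl fun J hJ => by rw [Finset.univ_inter, hl J hJ], Finset.sum_const, hS,
    Finset.card_fin, smul_eq_mul] at h1
  rw [hr, Nat.eq_of_mul_eq_mul_left (Fin.pos x) h1]

lemma mul_sub_one (h : IsSymmetricDesign l lam S) (hm : 0 < m) :
    l ^ 2 = l + (m - 1) * lam := by
  have h1 := sum_card_inter_sq h.card_filter_mem h.1.2.1 Finset.univ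
  rw [Finset.sum_congr rfl fun J hJ => by rw [Finset.univ_inter, h.1.1 J hJ], Finset.sum_const,
    h.2, Finset.card_fin, smul_eq_mul] at h1
  exact Nat.eq_of_mul_eq_mul_left hm h1

lemma pos (h : IsSymmetricDesign l lam S) (hm : 2 ≤ m) : 0 < l := by
  by_contra! h0
  -- The blocks form a set, so empty blocks would leave at most one of them instead of `m`.
  have h1 : S ⊆ {∅} := fun J hJ => by
    rw [Finset.mem_singleton, ← Finset.card_eq_zero, h.1.1 J hJ]
    lia
  have := Finset.card_le_card h1
  rw [h.2, Finset.card_singleton] at this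
  lia

lemma lt (h : IsSymmetricDesign l lam S) (hm : 2 ≤ m) : l < m := by
  by_contra! h0
  have h1 : S ⊆ {Finset.univ} := fun J hJ => by
    rw [Finset.mem_singleton, ← Finset.card_eq_iff_eq_univ, h.1.1 J hJ, Fintype.card_fin]
    refine le_antisymm ?_ h0
    rw [← h.1.1 J hJ]
    simpa using Finset.card_le_univ J
  have := Finset.card_le_card h1
  rw [h.2, Finset.card_singleton] at this
  lia

lemma ne_compl (h : IsSymmetricDesign l lam S) (hm : 2 < m) : l ≠ m - l := by
  intro h0
  have hlt := h.lt hm.le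
  obtain rfl : m = 2 * l := by lia
  have h1 := h.mul_sub_one (by lia)
  -- With `m = 2 * l`, four times the relation `l ^ 2 = l + (m - 1) * lam` reads `(2l - 1)(2l - 1 -
  -- 4 lam) = 1`.
  have h2 : (2 * (l : ℤ) - 1) ∣ 1 := by
    refine ⟨2 * l - 1 - 4 * lam, ?_⟩
    zify [show 1 ≤ 2 * l by lia] at h1
    linear_combination -4 * h1
  have := Int.le_of_dvd one_pos h2
  lia

/-- Two different blocks of a symmetric design have `lam` points in common. -/
lemma card_inter (h : IsSymmetricDesign l lam S) (hm : 2 ≤ m) {B J : Finset (Fin m)} (hB : B ∈ S)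
    (hJ : J ∈ S) (hBJ : B ≠ J) : (B ∩ J).card = lam := by
  have hsum := sum_card_inter h.card_filter_mem B
  have hsq := sum_card_inter_sq h.card_filter_mem h.1.2.1 B
  have hl := h.mul_sub_one (by lia)
  have hpos := h.pos hm
  rw [h.1.1 B hB] at hsum hsq
  -- Variance argument: the sum over all blocks is `(l - lam) ^ 2`, which the block `B` alone
  -- already contributes.
  have hzero : ∑ J ∈ S.erase B, (((B ∩ J).card : ℤ) - lam) ^ 2 = 0 := by
    have h1 : ∑ J ∈ S, (((B ∩ J).card : ℤ) - lam) ^ 2 = (l - lam) ^ 2 := by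
      simp only [sub_sq, Finset.sum_add_distrib, Finset.sum_sub_distrib, Finset.sum_const, h.2,
        ← Finset.sum_mul, ← Finset.mul_sum]
      zify [hpos, show 1 ≤ m by lia] at hsum hsq hl
      rw [hsum, hsq, nsmul_eq_mul]
      linear_combination (-(lam : ℤ)) * hl
    rw [← Finset.add_sum_erase _ _ hB, Finset.inter_self, h.1.1 B hB] at h1
    linarith
  have h2 := (Finset.sum_eq_zero_iff_of_nonneg fun J _ => sq_nonneg _).1 hzero J
    (Finset.mem_erase.2 ⟨hBJ.symm, hJ⟩)
  have h3 := pow_eq_zero_iff (two_ne_zero) |>.1 h2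
  lia

end IsSymmetricDesign

lemma card_complDesign (S : Finset (Finset (Fin m))) : (complDesign S).card = S.card :=
  Finset.card_image_of_injective _ compl_injective

end Design

/-! ### Coordinate projections -/

section CoordProj

variable {𝕜 : Type*} [RCLike 𝕜] {m : ℕ}
  (b : OrthonormalBasis (Fin m) 𝕜 (EuclideanSpace 𝕜 (Fin m)))

/-- The unitary matrix whose columns are the vectors of an orthonormal basis. -/
def basisMatrix : Matrix (Fin m) (Fin m) 𝕜 := Matrix.of fun i j => b j i

lemma conjTranspose_basisMatrix_mul : (basisMatrix b)ᴴ * basisMatrix b = 1 := by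
  ext i j
  have h := orthonormal_iff_ite.1 b.orthonormal i j
  rw [EuclideanSpace.inner_eq_star_dotProduct] at h
  simp only [mul_apply, basisMatrix, conjTranspose_apply, of_apply, one_apply, ← h, dotProduct]
  exact Finset.sum_congr rfl fun k _ => mul_comm _ _

lemma basisMatrix_mul_conjTranspose : basisMatrix b * (basisMatrix b)ᴴ = 1 :=
  mul_eq_one_comm.1 (conjTranspose_basisMatrix_mul b)

/-- The diagonal `0`-`1` matrix of a set. -/
def indicatorDiagonal (𝕜 : Type*) [RCLike 𝕜] (J : Finset (Fin m)) : Matrix (Fin m) (Fin m) 𝕜 :=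
  diagonal fun j => if j ∈ J then 1 else 0

lemma indicatorDiagonal_mul (J K : Finset (Fin m)) :
    indicatorDiagonal 𝕜 J * indicatorDiagonal 𝕜 K = indicatorDiagonal 𝕜 (J ∩ K) := by
  simp only [indicatorDiagonal, diagonal_mul_diagonal, Finset.mem_inter, ite_and]
  congr 1
  ext j
  split_ifs <;> simp

lemma trace_indicatorDiagonal (J : Finset (Fin m)) :
    (indicatorDiagonal 𝕜 J).trace = J.card := by
  simp [indicatorDiagonal, trace_diagonal]

lemma coordProj_eq (J : Finset (Fin m)) :
    coordProj b J = basisMatrix b * indicatorDiagonal 𝕜 J * (basisMatrix b)ᴴ := by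
  ext i k
  simp [coordProj, basisMatrix, indicatorDiagonal, mul_apply, Matrix.sum_apply, vecMulVec_apply,
    diagonal_apply]

lemma coordProj_mul (J K : Finset (Fin m)) :
    coordProj b J * coordProj b K = coordProj b (J ∩ K) := by
  simp only [coordProj_eq, ← indicatorDiagonal_mul]
  calc _ = basisMatrix b * indicatorDiagonal 𝕜 J * ((basisMatrix b)ᴴ * basisMatrix b) *
        indicatorDiagonal 𝕜 K * (basisMatrix b)ᴴ := by simp only [Matrix.mul_assoc]
    _ = _ := by rw [conjTranspose_basisMatrix_mul]; simp only [Matrix.mul_assoc, Matrix.one_mul]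

lemma coordProj_conjTranspose (J : Finset (Fin m)) : (coordProj b J)ᴴ = coordProj b J := by
  have h : (indicatorDiagonal 𝕜 J)ᴴ = indicatorDiagonal 𝕜 J := by
    rw [indicatorDiagonal, diagonal_conjTranspose]
    congr 1
    ext j
    simp [apply_ite]
  simp [coordProj_eq, h, Matrix.mul_assoc]

lemma isStarProjection_coordProj (J : Finset (Fin m)) : IsStarProjection (coordProj b J) :=
  ⟨by rw [IsIdempotentElem, coordProj_mul, Finset.inter_self], coordProj_conjTranspose b J⟩

lemma trace_coordProj (J : Finset (Fin m)) : (coordProj b J).trace = J.card := by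
  rw [coordProj_eq, trace_mul_cycle, conjTranspose_basisMatrix_mul, Matrix.one_mul,
    trace_indicatorDiagonal]

lemma rank_coordProj (J : Finset (Fin m)) : (coordProj b J).rank = J.card := by
  rw [coordProj_eq, rank_mul_eq_left_of_isUnit_det, rank_mul_eq_right_of_isUnit_det,
    indicatorDiagonal, rank_diagonal]
  · simp
  · exact (isUnit_iff_isUnit_det _).1 (IsUnit.of_mul_eq_one _ (basisMatrix_mul_conjTranspose b))
  · exact (isUnit_iff_isUnit_det _).1 (IsUnit.of_mul_eq_one _ (conjTranspose_basisMatrix_mul b))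

lemma coordProj_univ : coordProj b Finset.univ = 1 := by
  simp [coordProj_eq, indicatorDiagonal, basisMatrix_mul_conjTranspose]

lemma coordProj_compl (J : Finset (Fin m)) : coordProj b Jᶜ = 1 - coordProj b J := by
  rw [← coordProj_univ b, eq_sub_iff_add_eq']
  exact Finset.sum_add_sum_compl J _

/-- The projections onto coordinate subspaces of two unbiased bases have trace inner product
`l l' / m`. -/
lemma trace_coordProj_mul_of_unbiased (b' : OrthonormalBasis (Fin m) 𝕜 (EuclideanSpace 𝕜 (Fin m)))
    (h : ∀ j j', ‖inner 𝕜 (b j) (b' j')‖ ^ 2 = 1 / (m : ℝ)) (J K : Finset (Fin m)) :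
    (coordProj b J * coordProj b' K).trace = (J.card * K.card / m : 𝕜) := by
  have h1 : ∀ j j', (vecMulVec (fun i => b j i) (fun i => star (b j i)) *
      vecMulVec (fun i => b' j' i) (fun i => star (b' j' i))).trace = (1 / m : 𝕜) := by
    intro j j'
    have h2 : (inner 𝕜 (b j) (b' j') : 𝕜) =
        (fun i => star (b j i)) ⬝ᵥ (fun i => b' j' i) := by
      rw [EuclideanSpace.inner_eq_star_dotProduct, dotProduct_comm]
      rfl
    have h3 : (inner 𝕜 (b' j') (b j) : 𝕜) =
        (fun i => b j i) ⬝ᵥ (fun i => star (b' j' i)) := by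
      rw [EuclideanSpace.inner_eq_star_dotProduct]
      rfl
    rw [vecMulVec_mul_vecMulVec, trace_vecMulVec, dotProduct_smul, ← h2, ← h3, smul_eq_mul,
      ← inner_conj_symm (b' j') (b j), RCLike.mul_conj]
    rw [← RCLike.ofReal_pow, h]
    simp
  simp only [coordProj, Finset.sum_mul_sum, trace_sum, h1, Finset.sum_const, nsmul_eq_mul]
  ring

end CoordProj

/-! ### Inner products of embedded projections -/

section Embed

variable {𝕜 : Type*} [RCLike 𝕜] {m : ℕ}

lemma hsInner_embed {l l' : ℕ} (hm : m ≠ 0) {P Q : Matrix (Fin m) (Fin m) 𝕜} (hP : Pᴴ = P)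
    (hPl : P.trace = l) (hQl : Q.trace = l') :
    hsInner (embed l P) (embed l' Q) =
      (radius m l)⁻¹ * (radius m l')⁻¹ * (RCLike.re (P * Q).trace - l * l' / m) := by
  have hm' : (m : 𝕜) ≠ 0 := Nat.cast_ne_zero.2 hm
  have h : ((embed l P)ᴴ * embed l' Q).trace =
      (((radius m l)⁻¹ * (radius m l')⁻¹ : ℝ) : 𝕜) *
        ((P * Q).trace - ((l * l' / m : ℝ) : 𝕜)) := by
    simp only [embed, conjTranspose_smul, conjTranspose_sub, hP, conjTranspose_one,
      smul_mul_assoc, mul_smul_comm, trace_smul, sub_mul, mul_sub, trace_sub, hPl, hQl, trace_one,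
      Matrix.one_mul, Matrix.mul_one, smul_eq_mul, Fintype.card_fin]
    simp
    field_simp
    ring
  rw [hsInner, h, RCLike.re_ofReal_mul, map_sub, RCLike.ofReal_re]

end Embed

/-! ### The packing of a design and a maximal set of mutually unbiased bases -/

section Packing

variable {𝕜 : Type*} [RCLike 𝕜] {m l lam : ℕ} {S : Finset (Finset (Fin m))}

lemma sum_coordProj (b : OrthonormalBasis (Fin m) 𝕜 (EuclideanSpace 𝕜 (Fin m)))
    (hS : IsSymmetricDesign l lam S) :
    ∑ J ∈ S, coordProj b J = (l : 𝕜) • (1 : Matrix (Fin m) (Fin m) 𝕜) := by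
  have h : ∀ J ∈ S, coordProj b J = ∑ j, if j ∈ J then
      vecMulVec (fun i => b j i) (fun i => star (b j i)) else 0 := fun J _ => by
    rw [← Finset.sum_filter, Finset.filter_mem_eq_inter, Finset.univ_inter]
    rfl
  rw [Finset.sum_congr rfl h, Finset.sum_comm]
  simp only [← Finset.sum_filter, Finset.sum_const, hS.card_filter_mem]
  rw [← Finset.smul_sum, ← coordProj_univ b, Nat.cast_smul_eq_nsmul]
  rfl

lemma sum_coordProj_complDesign (b : OrthonormalBasis (Fin m) 𝕜 (EuclideanSpace 𝕜 (Fin m)))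
    (hS : IsSymmetricDesign l lam S) :
    ∑ J ∈ complDesign S, coordProj b J = ((m : 𝕜) - l) • (1 : Matrix (Fin m) (Fin m) 𝕜) := by
  rw [complDesign, Finset.sum_image fun _ _ _ _ h => compl_injective h]
  simp only [coordProj_compl, Finset.sum_sub_distrib, sum_coordProj b hS, Finset.sum_const, hS.2,
    sub_smul, Nat.cast_smul_eq_nsmul]

lemma hsInner_embed_coordProj_self (hm : m ≠ 0)
    (b : OrthonormalBasis (Fin m) 𝕜 (EuclideanSpace 𝕜 (Fin m))) {J K : Finset (Fin m)}
    (h : (J ∩ K).card * m ≤ J.card * K.card) :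
    hsInner (embed J.card (coordProj b J)) (embed K.card (coordProj b K)) ≤ 0 := by
  rw [hsInner_embed hm (coordProj_conjTranspose b J) (trace_coordProj b J) (trace_coordProj b K),
    coordProj_mul, trace_coordProj, RCLike.natCast_re]
  have hm' : (0 : ℝ) < m := Nat.cast_pos.2 (Nat.pos_of_ne_zero hm)
  refine mul_nonpos_of_nonneg_of_nonpos
    (mul_nonneg (inv_nonneg.2 (Real.sqrt_nonneg _)) (inv_nonneg.2 (Real.sqrt_nonneg _))) ?_
  rw [sub_nonpos, le_div_iff₀ hm']
  exact_mod_cast h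

lemma hsInner_embed_coordProj_of_unbiased (hm : m ≠ 0)
    {b b' : OrthonormalBasis (Fin m) 𝕜 (EuclideanSpace 𝕜 (Fin m))}
    (h : ∀ j j', ‖inner 𝕜 (b j) (b' j')‖ ^ 2 = 1 / (m : ℝ)) (J K : Finset (Fin m)) :
    hsInner (embed J.card (coordProj b J)) (embed K.card (coordProj b' K)) = 0 := by
  rw [hsInner_embed hm (coordProj_conjTranspose b J) (trace_coordProj b J) (trace_coordProj b' K),
    trace_coordProj_mul_of_unbiased b b' h]
  have : (J.card * K.card / m : 𝕜) = ((J.card * K.card / m : ℝ) : 𝕜) := by simp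
  rw [this, RCLike.ofReal_re, sub_self, mul_zero]

lemma IsSymmetricDesign.card_inter_mul_le (h : IsSymmetricDesign l lam S) (hm : 2 ≤ m)
    {J K : Finset (Fin m)} (hJ : J ∈ S) (hK : K ∈ S) (hJK : J ≠ K) :
    (J ∩ K).card * m ≤ J.card * K.card := by
  have h1 := h.mul_sub_one (by lia)
  have h2 : lam ≤ l := by
    rw [← h.card_inter hm hJ hK hJK, ← h.1.1 J hJ]
    exact Finset.card_le_card Finset.inter_subset_left
  rw [h.card_inter hm hJ hK hJK, h.1.1 J hJ, h.1.1 K hK, ← sq, h1]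
  obtain ⟨n, rfl⟩ : ∃ n, m = n + 1 := ⟨m - 1, by lia⟩
  rw [Nat.add_sub_cancel]
  nlinarith

/-- The difference `|J ∩ K| m - |J| |K|` is unchanged when both sets are complemented. -/
lemma card_inter_compl_mul_le {J K : Finset (Fin m)} (h : (J ∩ K).card * m ≤ J.card * K.card) :
    (Jᶜ ∩ Kᶜ).card * m ≤ Jᶜ.card * Kᶜ.card := by
  have h1 := Finset.card_union_add_card_inter J K
  have h2 := Finset.card_add_card_compl J
  have h3 := Finset.card_add_card_compl K
  have h4 := Finset.card_add_card_compl (J ∪ K)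
  rw [Fintype.card_fin] at h2 h3 h4
  rw [← Finset.compl_union]
  zify at *
  obtain h5 : (((J ∪ K)ᶜ).card : ℤ) = m - J.card - K.card + (J ∩ K).card := by linarith
  rw [h5, show (Jᶜ.card : ℤ) = m - J.card by linarith, show (Kᶜ.card : ℤ) = m - K.card by linarith]
  linarith

/-- The family built from a symmetric design, its complement and a set of mutually unbiased bases
with `d + 2` or more elements, where `d` is the dimension of the space of Hermitian matrices. -/
theorem isTightOptimalMixedPacking_unionFamily {κ : Type*} [Fintype κ] [DecidableEq κ]
    {F : Type*} [AddCommGroup F] [Module ℝ F] [FiniteDimensional ℝ F]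
    (f : F →ₗ[ℝ] Matrix (Fin m) (Fin m) 𝕜)
    (hf : ∀ A : Matrix (Fin m) (Fin m) 𝕜, A.IsHermitian → A ∈ LinearMap.range f)
    (hcard : Module.finrank ℝ F + 1 < Fintype.card κ * m) (hm : 2 < m)
    (hS : IsSymmetricDesign l lam S)
    {B : κ → OrthonormalBasis (Fin m) 𝕜 (EuclideanSpace 𝕜 (Fin m))} (hB : IsMUB B)
    {A₁ A₂ : Finset κ} (hA : IsTwoPartition A₁ A₂) :
    IsTightOptimalMixedPacking (unionFamily B A₁ A₂ S (complDesign S)) 2 := by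
  obtain ⟨⟨k₁, hk₁⟩, ⟨k₂, hk₂⟩, hdisj, hunion⟩ := hA
  have hl := hS.pos hm.le
  have hlm := hS.lt hm.le
  have hm0 : m ≠ 0 := by lia
  obtain ⟨J₀, hJ₀⟩ : S.Nonempty := by
    rw [← Finset.card_pos, hS.2]
    lia
  have hJ₀' : J₀ᶜ ∈ complDesign S := Finset.mem_image_of_mem _ hJ₀
  have hcompl : ∀ J ∈ complDesign S, ∃ K ∈ S, J = Kᶜ := fun J hJ => by
    obtain ⟨K, hK, rfl⟩ := Finset.mem_image.1 hJ
    exact ⟨K, hK, rfl⟩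
  have hcard_compl : ∀ J ∈ complDesign S, J.card = m - l := fun J hJ => by
    obtain ⟨K, hK, rfl⟩ := hcompl J hJ
    rw [Finset.card_compl, Fintype.card_fin, hS.1.1 K hK]
  have hproj : ∀ i, IsStarProjection (unionFamily B A₁ A₂ S (complDesign S) i) := by
    rintro (i | i) <;> exact isStarProjection_coordProj _ _
  have hr₁ : ∀ i, (unionFamily B A₁ A₂ S (complDesign S) (Sum.inl i)).rank = l := fun i =>
    (rank_coordProj _ _).trans (hS.1.1 _ i.2.2)
  have hr₂ : ∀ i, (unionFamily B A₁ A₂ S (complDesign S) (Sum.inr i)).rank = m - l := fun i =>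
    (rank_coordProj _ _).trans (hcard_compl _ i.2.2)
  have hrank : ∀ i, 0 < (unionFamily B A₁ A₂ S (complDesign S) i).rank ∧
      (unionFamily B A₁ A₂ S (complDesign S) i).rank < m := by
    rintro (i | i)
    · rw [hr₁]
      exact ⟨hl, hlm⟩
    · rw [hr₂]
      lia
  have hne : ∀ k ∈ A₁, ∀ k' ∈ A₂, k ≠ k' := fun k hk k' hk' h =>
    Finset.disjoint_left.1 hdisj hk (h ▸ hk')
  refine ⟨fun i => ⟨hproj i, (hrank i).1, (hrank i).2.le⟩, ?_, ?_, ?_, by norm_num⟩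
  · have hsum : ∑ i, unionFamily B A₁ A₂ S (complDesign S) i =
        ((A₁.card * l + A₂.card * (m - l) : ℝ) : 𝕜) • (1 : Matrix (Fin m) (Fin m) 𝕜) := by
      rw [Fintype.sum_sum_type, Fintype.sum_prod_type, Fintype.sum_prod_type]
      simp only [unionFamily, Sum.elim_inl, Sum.elim_inr]
      have h1 : ∀ k : κ, ∑ J : S, coordProj (B k) J = (l : 𝕜) • 1 := fun k => by
        rw [Finset.sum_coe_sort S (fun J => coordProj (B k) J), sum_coordProj _ hS]
      have h2 : ∀ k : κ, ∑ J : complDesign S, coordProj (B k) J = ((m : 𝕜) - l) • 1 := fun k => by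
        rw [Finset.sum_coe_sort (complDesign S) (fun J => coordProj (B k) J),
          sum_coordProj_complDesign _ hS]
      simp only [h1, h2, Finset.sum_const, Finset.card_univ, Fintype.card_coe,
        ← Nat.cast_smul_eq_nsmul 𝕜, smul_smul, ← add_smul]
      simp
    have hpos : (0 : ℝ) < A₁.card * l + A₂.card * (m - l) := by
      have h1 : (0 : ℝ) < A₁.card := Nat.cast_pos.2 (Finset.card_pos.2 ⟨k₁, hk₁⟩)
      have h2 : (0 : ℝ) < l := Nat.cast_pos.2 hl
      have h3 : (0 : ℝ) < m - l := sub_pos.2 (Nat.cast_lt.2 hlm)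
      positivity
    refine ⟨?_, _, hsum⟩
    rw [hsum]
    exact PosDef.one.smul (by exact_mod_cast hpos)
  · refine isOptimallySpread_of_card f hf ?_ _ hproj hrank ?_ ?_
    -- Every basis carries `m` projections, whichever part it belongs to.
    · rw [Fintype.card_sum, Fintype.card_prod, Fintype.card_prod]
      simp only [Fintype.card_coe, card_complDesign, hS.2]
      rwa [← add_mul, ← Finset.card_union_of_disjoint hdisj, hunion, Finset.card_univ]
    · rintro (⟨k, J⟩ | ⟨k, J⟩) (⟨k', K⟩ | ⟨k', K⟩) hij <;>
        simp only [unionFamily, Sum.elim_inl, Sum.elim_inr, rank_coordProj]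
      · by_cases hk : k = k'
        · subst hk
          refine hsInner_embed_coordProj_self hm0 _ (hS.card_inter_mul_le hm.le J.2 K.2 ?_)
          exact fun h => hij (by rw [Subtype.ext h])
        · exact (hsInner_embed_coordProj_of_unbiased hm0
            (hB _ _ fun h => hk (Subtype.ext h)) _ _).le
      · exact (hsInner_embed_coordProj_of_unbiased hm0
          (hB _ _ (hne _ k.2 _ k'.2)) _ _).le
      · exact (hsInner_embed_coordProj_of_unbiased hm0
          (hB _ _ (hne _ k'.2 _ k.2).symm) _ _).le
      · by_cases hk : k = k'
        · subst hk
          obtain ⟨J', hJ', hJ⟩ := hcompl J J.2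
          obtain ⟨K', hK', hK⟩ := hcompl K K.2
          rw [hJ, hK]
          refine hsInner_embed_coordProj_self hm0 _
            (card_inter_compl_mul_le (hS.card_inter_mul_le hm.le hJ' hK' ?_))
          rintro rfl
          exact hij (by rw [Subtype.ext (hJ.trans hK.symm)])
        · exact (hsInner_embed_coordProj_of_unbiased hm0
            (hB _ _ fun h => hk (Subtype.ext h)) _ _).le
    -- Both parts are nonempty, so two different bases occur and give an orthogonal pair.
    · refine ⟨Sum.inl (⟨k₁, hk₁⟩, ⟨J₀, hJ₀⟩), Sum.inr (⟨k₂, hk₂⟩, ⟨J₀ᶜ, hJ₀'⟩), Sum.inl_ne_inr, ?_⟩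
      simp only [unionFamily, Sum.elim_inl, Sum.elim_inr, rank_coordProj]
      exact hsInner_embed_coordProj_of_unbiased hm0 (hB _ _ (hne _ hk₁ _ hk₂)) _ _
  · have : (Finset.univ.image fun i => (unionFamily B A₁ A₂ S (complDesign S) i).rank) =
        {l, m - l} := by
      ext n
      simp only [Finset.mem_image, Finset.mem_univ, true_and, Finset.mem_insert,
        Finset.mem_singleton]
      constructor
      · rintro ⟨i | i, rfl⟩
        · exact Or.inl (hr₁ i)
        · exact Or.inr (hr₂ i)
      · rintro (rfl | rfl)
        · exact ⟨Sum.inl (⟨k₁, hk₁⟩, ⟨J₀, hJ₀⟩), hr₁ _⟩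
        · exact ⟨Sum.inr (⟨k₂, hk₂⟩, ⟨J₀ᶜ, hJ₀'⟩), hr₂ _⟩
    rw [mixture, this, Finset.card_pair (hS.ne_compl hm)]

end Packing

/-! ### Mutually unbiased bases from families of bilinear forms -/

section Unbiased

variable {𝕜 : Type*} [RCLike 𝕜] {V : Type*} [AddCommGroup V] [Fintype V]

/-- The absolute value of a nondegenerate quadratic exponential sum. -/
lemma norm_sum_sq_of_quadratic {f : V → 𝕜} {γ : V → V → 𝕜} (hf : ∀ x, ‖f x‖ = 1)
    (hadd : ∀ x h, f (x + h) = f x * f h * γ x h) (hγ : ∀ h, h ≠ 0 → ∑ x, γ x h = 0) :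
    ‖∑ x, f x‖ ^ 2 = Fintype.card V := by
  have hconj : ∀ x, f x * (starRingEnd 𝕜) (f x) = 1 := fun x => by
    rw [RCLike.mul_conj, hf]
    simp
  have h1 : ((‖∑ x, f x‖ ^ 2 : ℝ) : 𝕜) = Fintype.card V := by
    rw [RCLike.ofReal_pow, ← RCLike.mul_conj, mul_comm, map_sum, Finset.sum_mul_sum]
    -- After the substitution `y = x + h` the sum over `x` is `f h * ∑ x, γ x h`, so only `h = 0`
    -- survives.
    have h2 : ∀ x, ∑ y, (starRingEnd 𝕜) (f x) * f y =
        ∑ h, (starRingEnd 𝕜) (f x) * f (x + h) := fun x =>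
      (Fintype.sum_equiv (Equiv.addLeft x) _ _ fun h => rfl).symm
    simp only [h2]
    rw [Finset.sum_comm, Finset.sum_eq_single 0]
    · simp [mul_comm, hconj]
    · intro h _ hh
      have h3 : ∀ x, (starRingEnd 𝕜) (f x) * f (x + h) = f h * γ x h := fun x => by
        rw [hadd]
        linear_combination f h * γ x h * hconj x
      simp only [h3, ← Finset.mul_sum, hγ h hh, mul_zero]
    · simp
  exact_mod_cast h1

variable {p : ℕ} [Fact p.Prime] [Module (ZMod p) V]

lemma sum_addChar_eq_zero {e : AddChar (ZMod p) 𝕜} (he : ∀ c, e c = 1 → c = 0)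
    {φ : V →ₗ[ZMod p] ZMod p} (hφ : φ ≠ 0) : ∑ x, e (φ x) = 0 := by
  have h : e.compAddMonoidHom φ.toAddMonoidHom ≠ 0 := by
    intro h0
    refine hφ (LinearMap.ext fun x => he _ ?_)
    simpa using DFunLike.congr_fun h0 x
  simpa using AddChar.sum_eq_zero_iff_ne_zero.2 h

/-- The vector with the entries `χ x e(D y x) / √m`. -/
def quadraticVector {m : ℕ} (σ : Fin m ≃ V) (e : AddChar (ZMod p) 𝕜)
    (D : LinearMap.BilinForm (ZMod p) V) (χ : V → 𝕜) (y : V) : EuclideanSpace 𝕜 (Fin m) :=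
  WithLp.toLp 2 fun i => (((Real.sqrt m)⁻¹ : ℝ) : 𝕜) * (χ (σ i) * e (D y (σ i)))

/-- Orthonormality and unbiasedness both become statements about exponential sums on `V`. -/
lemma inner_quadraticVector {m : ℕ} (σ : Fin m ≃ V) (e : AddChar (ZMod p) 𝕜)
    (D : LinearMap.BilinForm (ZMod p) V) (χ χ' : V → 𝕜) (y y' : V) :
    inner 𝕜 (quadraticVector σ e D χ y) (quadraticVector σ e D χ' y') =
      (((m : ℝ)⁻¹ : ℝ) : 𝕜) * ∑ x, (starRingEnd 𝕜) (χ x) * χ' x * e (D (y' - y) x) := by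
  rw [quadraticVector, quadraticVector, EuclideanSpace.inner_toLp_toLp, dotProduct,
    Finset.mul_sum, ← σ.sum_comp]
  refine Finset.sum_congr rfl fun i _ => ?_
  have h1 : (((m : ℝ)⁻¹ : ℝ) : 𝕜) = (((Real.sqrt m)⁻¹ : ℝ) : 𝕜) * (((Real.sqrt m)⁻¹ : ℝ) : 𝕜) := by
    rw [← RCLike.ofReal_mul, ← mul_inv, Real.mul_self_sqrt (Nat.cast_nonneg m)]
  rw [h1, sub_eq_add_neg, map_add, LinearMap.add_apply, AddChar.map_add_eq_mul, map_neg,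
    LinearMap.neg_apply, AddChar.map_neg_eq_conj]
  simp only [Pi.star_apply, RCLike.star_def, map_mul, RCLike.conj_ofReal]
  ring

/-- A family of functions refining bilinear forms with nondegenerate differences yields a set of
mutually unbiased bases that also contains the standard basis. -/
theorem exists_isMUB_of_refinement {m : ℕ} (hm : Fintype.card V = m)
    {e : AddChar (ZMod p) 𝕜} (he : ∀ c, e c = 1 → c = 0)
    {D : LinearMap.BilinForm (ZMod p) V} (hD : ∀ y, (∀ x, D y x = 0) → y = 0)
    {K : Type*} {β : K → LinearMap.BilinForm (ZMod p) V} {χ : K → V → 𝕜}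
    (hχ : ∀ s x, ‖χ s x‖ = 1)
    (hadd : ∀ s x y, χ s (x + y) = χ s x * χ s y * e (β s x y))
    (hβ : ∀ s t, s ≠ t → ∀ y, (∀ x, β s x y = β t x y) → y = 0) :
    ∃ B : Option K → OrthonormalBasis (Fin m) 𝕜 (EuclideanSpace 𝕜 (Fin m)), IsMUB B := by
  have hm0 : (m : ℝ) ≠ 0 := by
    rw [← hm]
    exact Nat.cast_ne_zero.2 Fintype.card_ne_zero
  let σ : Fin m ≃ V := (finCongr hm.symm).trans (Fintype.equivFin V).symm
  have hon : ∀ s, Orthonormal 𝕜 fun j => quadraticVector σ e D (χ s) (σ j) := by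
    intro s
    rw [orthonormal_iff_ite]
    intro i j
    have h1 : ∀ x, (starRingEnd 𝕜) (χ s x) * χ s x = 1 := fun x => by
      rw [RCLike.conj_mul, hχ]
      simp
    rw [inner_quadraticVector]
    simp only [h1, one_mul]
    split_ifs with hij
    · subst hij
      simp only [sub_self, map_zero, LinearMap.zero_apply, AddChar.map_zero_eq_one,
        Finset.sum_const, Finset.card_univ, hm, nsmul_eq_mul, mul_one]
      rw [← RCLike.ofReal_natCast (K := 𝕜), ← RCLike.ofReal_mul, inv_mul_cancel₀ hm0,
        RCLike.ofReal_one]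
    · rw [sum_addChar_eq_zero he, mul_zero]
      intro h0
      have := hD (σ j - σ i) fun x => by rw [h0, LinearMap.zero_apply]
      exact hij (σ.injective (sub_eq_zero.1 this).symm)
  have hex : ∀ s, ∃ b : OrthonormalBasis (Fin m) 𝕜 (EuclideanSpace 𝕜 (Fin m)),
      ∀ j, b j = quadraticVector σ e D (χ s) (σ j) := fun s => by
    obtain ⟨b, hb⟩ := Orthonormal.exists_orthonormalBasis_extension_of_card_eq (𝕜 := 𝕜)
      (E := EuclideanSpace 𝕜 (Fin m)) (ι := Fin m) (by simp) (s := Set.univ)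
      (v := fun j => quadraticVector σ e D (χ s) (σ j))
      ((hon s).comp _ Subtype.val_injective)
    exact ⟨b, fun j => hb j (Set.mem_univ j)⟩
  choose b hb using hex
  have hstd : ∀ s j j', ‖inner 𝕜 (EuclideanSpace.basisFun (Fin m) 𝕜 j) (b s j')‖ ^ 2 =
      1 / (m : ℝ) := by
    intro s j j'
    rw [hb, EuclideanSpace.basisFun_apply, EuclideanSpace.inner_single_left]
    simp only [quadraticVector, map_one, one_mul, norm_mul, hχ, AddChar.norm_apply, mul_one]
    rw [RCLike.norm_ofReal, sq_abs, inv_pow, Real.sq_sqrt (Nat.cast_nonneg m), one_div]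
  refine ⟨fun o => o.elim (EuclideanSpace.basisFun (Fin m) 𝕜) b, ?_⟩
  rintro (_ | s) (_ | t) hst j j'
  · exact absurd rfl hst
  · exact hstd t j j'
  · rw [norm_inner_symm]
    exact hstd s j' j
  · simp only [Option.elim_some]
    have hst' : s ≠ t := fun h => hst (congrArg some h)
    -- The summand is again quadratic, with polar form `β t - β s`; the character `e (D (y' - y) x)`
    -- does not affect it.
    rw [hb, hb, inner_quadraticVector, norm_mul, mul_pow,
      norm_sum_sq_of_quadratic (γ := fun x h => e ((β t - β s) x h)), hm, RCLike.norm_ofReal,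
      sq_abs]
    · field_simp
    · intro x
      simp [hχ, AddChar.norm_apply]
    · intro x h
      rw [hadd, hadd, map_add, AddChar.map_add_eq_mul, LinearMap.sub_apply, LinearMap.sub_apply,
        sub_eq_add_neg (β t x h), AddChar.map_add_eq_mul, AddChar.map_neg_eq_conj]
      simp only [map_mul]
      ring
    · intro h hh
      refine sum_addChar_eq_zero he (φ := (β t - β s).flip h) fun h0 => hh ?_
      refine hβ t s hst'.symm h fun x => ?_
      simpa [sub_eq_zero] using DFunLike.congr_fun h0 x

end Unbiased

/-! ### Refinements of bilinear forms -/

section Refinement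

variable {𝕜 : Type*} [RCLike 𝕜] {V : Type*} [AddCommGroup V]

/-- A symmetric bilinear form in odd characteristic is refined by half its quadratic form. -/
lemma exists_refinement_of_ne_two {p : ℕ} [Fact p.Prime] (hp : p ≠ 2) [Module (ZMod p) V]
    (e : AddChar (ZMod p) 𝕜) (β : LinearMap.BilinForm (ZMod p) V) (hβ : ∀ x y, β x y = β y x) :
    ∃ χ : V → 𝕜, (∀ x, ‖χ x‖ = 1) ∧ ∀ x y, χ (x + y) = χ x * χ y * e (β x y) := by
  have h2 : (2 : ZMod p) ≠ 0 := Ring.two_ne_zero (by rwa [ZMod.ringChar_zmod_n])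
  refine ⟨fun x => e (2⁻¹ * β x x), fun x => AddChar.norm_apply _ _, fun x y => ?_⟩
  rw [← AddChar.map_add_eq_mul, ← AddChar.map_add_eq_mul]
  refine congrArg e ?_
  simp only [map_add, LinearMap.add_apply, hβ y x]
  linear_combination (β x y) * (inv_mul_cancel₀ h2)

/-- A symmetric bilinear form over `ZMod 2` that can be refined on all lines can be refined. -/
lemma exists_refinement_of_lines [Module (ZMod 2) V] [Finite V]
    (e : AddChar (ZMod 2) 𝕜) (β : LinearMap.BilinForm (ZMod 2) V) (hβ : ∀ x y, β x y = β y x)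
    (g : V → ZMod 2 → 𝕜) (hg : ∀ v c, ‖g v c‖ = 1)
    (hadd : ∀ v c d, g v (c + d) = g v c * g v d * e (c * d * β v v)) :
    ∃ χ : V → 𝕜, (∀ x, ‖χ x‖ = 1) ∧ ∀ x y, χ (x + y) = χ x * χ y * e (β x y) := by
  have : Module.Finite (ZMod 2) V := Module.Finite.of_finite
  let b := Module.finBasis (ZMod 2) V
  -- Halving is impossible over `ZMod 2`. The strictly upper triangular part `C` of the Gram matrix
  -- replaces half the form off the diagonal, and `g` treats the diagonal one basis vector at a
  -- time.
  let C : V → V → ZMod 2 := fun x y =>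
    ∑ i, ∑ j, if i < j then b.repr x i * b.repr y j * β (b i) (b j) else 0
  have hC : ∀ x y, C (x + y) (x + y) = C x x + C y y + (C x y + C y x) := by
    intro x y
    simp only [C, ← Finset.sum_add_distrib]
    refine Finset.sum_congr rfl fun i _ => Finset.sum_congr rfl fun j _ => ?_
    split_ifs
    · simp only [map_add, Finsupp.add_apply]
      ring
    · simp
  have hβC : ∀ x y, β x y =
      ∑ i, b.repr x i * b.repr y i * β (b i) (b i) + (C x y + C y x) := by
    intro x y
    have h1 : C y x = ∑ i, ∑ j, if j < i then b.repr x i * b.repr y j * β (b i) (b j) else 0 := by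
      simp only [C]
      rw [Finset.sum_comm]
      refine Finset.sum_congr rfl fun i _ => Finset.sum_congr rfl fun j _ => ?_
      rw [hβ (b j), mul_comm (b.repr y j)]
    have h2 : ∑ i, b.repr x i * b.repr y i * β (b i) (b i) =
        ∑ i, ∑ j, if i = j then b.repr x i * b.repr y j * β (b i) (b j) else 0 := by simp
    conv_lhs => rw [← b.sum_repr x, ← b.sum_repr y]
    rw [h1, h2]
    simp only [map_sum, LinearMap.sum_apply, map_smul, LinearMap.smul_apply, smul_eq_mul, C,
      ← Finset.sum_add_distrib, Finset.mul_sum]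
    conv_lhs => rw [Finset.sum_comm]
    refine Finset.sum_congr rfl fun i _ => Finset.sum_congr rfl fun j _ => ?_
    rcases lt_trichotomy i j with h | h | h
    · simp [h, h.ne, h.not_gt]
      ring
    · simp [h]
      ring
    · simp [h, h.ne', h.not_gt]
      ring
  refine ⟨fun x => (∏ i, g (b i) (b.repr x i)) * e (C x x), fun x => ?_, fun x y => ?_⟩
  · simp [hg, AddChar.norm_apply]
  · have he : ∏ i, e (b.repr x i * b.repr y i * β (b i) (b i)) =
        e (∑ i, b.repr x i * b.repr y i * β (b i) (b i)) := by
      generalize (Finset.univ : Finset (Fin (Module.finrank (ZMod 2) V))) = s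
      induction s using Finset.induction_on with
      | empty => simp
      | insert i s hi ih => rw [Finset.prod_insert hi, Finset.sum_insert hi, ih, e.map_add_eq_mul]
    simp only [map_add, Finsupp.add_apply, hadd, Finset.prod_mul_distrib, he]
    rw [hC, hβC]
    simp only [AddChar.map_add_eq_mul]
    ring

end Refinement

/-! ### Maximal sets of mutually unbiased bases -/

section Maximal

lemma eq_zero_of_forall_trace_mul {p : ℕ} [Fact p.Prime] {F : Type*} [Field F] [Finite F]
    [Algebra (ZMod p) F] {y : F} (h : ∀ x, Algebra.trace (ZMod p) F (y * x) = 0) : y = 0 :=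
  (traceForm_nondegenerate (ZMod p) F).1 y h

/-- A symmetric bilinear form over `ZMod 2` is refined by a function with values in the fourth roots
of unity. -/
lemma exists_refinement_complex {V : Type*} [AddCommGroup V] [Module (ZMod 2) V] [Finite V]
    {e : AddChar (ZMod 2) ℂ} (he : ∀ c, e c = 1 → c = 0)
    (β : LinearMap.BilinForm (ZMod 2) V) (hβ : ∀ x y, β x y = β y x) :
    ∃ χ : V → ℂ, (∀ x, ‖χ x‖ = 1) ∧ ∀ x y, χ (x + y) = χ x * χ y * e (β x y) := by
  have he1 : e 1 = -1 := by
    have h1 : e 1 * e 1 = 1 := by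
      rw [← AddChar.map_add_eq_mul, show (1 : ZMod 2) + 1 = 0 from rfl, AddChar.map_zero_eq_one]
    exact (mul_self_eq_one_iff.1 h1).resolve_left fun h => one_ne_zero (he 1 h)
  have h01 : ∀ c : ZMod 2, c = 0 ∨ c = 1 := by decide
  -- On a line with `β v v = 1`, the relation `1 = χ (v + v) = χ v ^ 2 * e 1` and `e 1 = -1` force
  -- `χ v = ±I`.
  refine exists_refinement_of_lines e β hβ
    (fun v c => if β v v = 1 ∧ c = 1 then Complex.I else 1) (fun v c => ?_) fun v c d => ?_
  · split_ifs <;> simp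
  · have h11 : (1 : ZMod 2) + 1 = 0 := rfl
    rcases h01 (β v v) with h | h <;> rcases h01 c with rfl | rfl <;>
      rcases h01 d with rfl | rfl <;> simp [h, he1, h11]

theorem exists_isMUB_complex {m : ℕ} (hm : IsPrimePow m) :
    ∃ B : Fin (m + 1) → OrthonormalBasis (Fin m) ℂ (EuclideanSpace ℂ (Fin m)), IsMUB B := by
  obtain ⟨p, n, hp, hn, rfl⟩ := (isPrimePow_nat_iff m).1 hm
  have : Fact p.Prime := ⟨hp⟩
  let F := GaloisField p n
  have : Fintype F := Fintype.ofFinite F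
  have hcard : Fintype.card F = p ^ n := by
    rw [← Nat.card_eq_fintype_card]
    exact GaloisField.card p n hn.ne'
  let e : AddChar (ZMod p) ℂ := ZMod.stdAddChar
  have he : ∀ c, e c = 1 → c = 0 := fun c hc =>
    ZMod.injective_stdAddChar (hc.trans (AddChar.map_zero_eq_one _).symm)
  let β : F → LinearMap.BilinForm (ZMod p) F := fun s =>
    (Algebra.traceForm (ZMod p) F).compLeft (LinearMap.mulLeft (ZMod p) s)
  have hβ : ∀ s x y, β s x y = Algebra.trace (ZMod p) F (s * x * y) := fun s x y => rfl
  have hsymm : ∀ s x y, β s x y = β s y x := fun s x y => by rw [hβ, hβ, mul_right_comm]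
  have hχ : ∀ s, ∃ χ : F → ℂ, (∀ x, ‖χ x‖ = 1) ∧ ∀ x y, χ (x + y) = χ x * χ y * e (β s x y) := by
    intro s
    by_cases h2 : p = 2
    · subst h2
      exact exists_refinement_complex he (β s) (hsymm s)
    · exact exists_refinement_of_ne_two h2 e (β s) (hsymm s)
  choose χ hχ1 hχ2 using hχ
  obtain ⟨B, hB⟩ := exists_isMUB_of_refinement hcard he (D := Algebra.traceForm (ZMod p) F)
    (fun y hy => eq_zero_of_forall_trace_mul hy) hχ1 hχ2 fun s t hst y hy => by
      have h1 : (s - t) * y = 0 := eq_zero_of_forall_trace_mul (p := p) fun x => by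
        have := hy x
        rw [hβ, hβ, ← sub_eq_zero, ← map_sub] at this
        rw [← this]
        congr 1
        ring
      exact (mul_eq_zero.1 h1).resolve_left (sub_ne_zero.2 hst)
  let σ : Fin (p ^ n + 1) ≃ Option F :=
    Fintype.equivOfCardEq (by rw [Fintype.card_fin, Fintype.card_option, hcard])
  exact ⟨B ∘ σ, fun k k' hk => hB _ _ (σ.injective.ne hk)⟩

/-- The alternating forms of the Kerdock set of a field with `2 ^ n` elements. -/
def kerdockForm (F : Type*) [Field F] [Algebra (ZMod 2) F] (s : F) :
    LinearMap.BilinForm (ZMod 2) (F × ZMod 2) :=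
  LinearMap.mk₂ (ZMod 2) (fun v w => Algebra.trace (ZMod 2) F (s ^ 2 * v.1 * w.1) +
      Algebra.trace (ZMod 2) F (s * v.1) * Algebra.trace (ZMod 2) F (s * w.1) +
      v.2 * Algebra.trace (ZMod 2) F (s * w.1) + w.2 * Algebra.trace (ZMod 2) F (s * v.1))
    (fun u v w => by simp only [Prod.fst_add, Prod.snd_add, mul_add, add_mul, map_add]; ring)
    (fun c v w => by
      simp only [Prod.smul_fst, Prod.smul_snd, mul_smul_comm, smul_mul_assoc, map_smul, smul_eq_mul]
      ring)
    (fun u v w => by simp only [Prod.fst_add, Prod.snd_add, mul_add, add_mul, map_add]; ring)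
    (fun c v w => by
      simp only [Prod.smul_fst, Prod.smul_snd, mul_smul_comm, map_smul, smul_eq_mul]
      ring)

-- Alternation and nondegeneracy in the Kerdock set

section Kerdock

variable {F : Type*} [Field F] [Algebra (ZMod 2) F]

lemma kerdockForm_apply (s : F) (v w : F × ZMod 2) : kerdockForm F s v w =
    Algebra.trace (ZMod 2) F (s ^ 2 * v.1 * w.1) +
      Algebra.trace (ZMod 2) F (s * v.1) * Algebra.trace (ZMod 2) F (s * w.1) +
      v.2 * Algebra.trace (ZMod 2) F (s * w.1) + w.2 * Algebra.trace (ZMod 2) F (s * v.1) := rfl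

lemma kerdockForm_symm (s : F) (v w : F × ZMod 2) : kerdockForm F s v w = kerdockForm F s w v := by
  rw [kerdockForm_apply, kerdockForm_apply, mul_right_comm]
  ring

variable [Finite F]

lemma trace_sq (x : F) : Algebra.trace (ZMod 2) F (x ^ 2) = Algebra.trace (ZMod 2) F x := by
  have h := Algebra.trace_eq_of_algEquiv (FiniteField.frobeniusAlgEquivOfAlgebraic (ZMod 2) F) x
  simpa using h

/-- Alternation is what lets a sign-valued function refine the form. It holds since `Tr (x ^ 2) = Tr
x` and `c + c * c = 0` in `ZMod 2`. -/
lemma kerdockForm_self (s : F) (v : F × ZMod 2) : kerdockForm F s v v = 0 := by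
  have h1 : ∀ c : ZMod 2, c + c * c = 0 := by decide
  have h2 : ∀ c : ZMod 2, c + c = 0 := by decide
  rw [kerdockForm_apply, mul_assoc, ← sq, ← mul_pow, trace_sq, h1, zero_add, h2]

/-- The difference of two forms of a Kerdock set is nondegenerate if the degree of the field is
odd. -/
lemma eq_zero_of_kerdockForm_eq (hodd : Odd (Module.finrank (ZMod 2) F)) {s t : F} (hst : s ≠ t)
    (w : F × ZMod 2) (h : ∀ v, kerdockForm F s v w = kerdockForm F t v w) : w = 0 := by
  obtain ⟨y, b⟩ := w
  have hchar : CharP F 2 := charP_of_injective_algebraMap (algebraMap (ZMod 2) F).injective 2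
  have hst' : s - t ≠ 0 := sub_ne_zero.2 hst
  simp only [kerdockForm_apply] at h
  have hc : Algebra.trace (ZMod 2) F (s * y) = Algebra.trace (ZMod 2) F (t * y) := by
    simpa using h (0, 1)
  set c := Algebra.trace (ZMod 2) F (t * y)
  -- Testing against all `(x, 0)` gives an identity of traces, which nondegeneracy of the trace form
  -- turns into an equation in `F`.
  have h1 : (s ^ 2 - t ^ 2) * y + (s - t) * algebraMap (ZMod 2) F (c + b) = 0 := by
    refine eq_zero_of_forall_trace_mul (p := 2) fun x => ?_
    have hx := h (x, 0)
    simp only [zero_mul, add_zero, hc] at hx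
    have h2 : ((s ^ 2 - t ^ 2) * y + (s - t) * algebraMap (ZMod 2) F (c + b)) * x =
        s ^ 2 * x * y - t ^ 2 * x * y + ((c + b) • (s * x) - (c + b) • (t * x)) := by
      simp only [Algebra.smul_def]
      ring
    rw [h2]
    simp only [map_add, map_sub, map_smul, smul_eq_mul]
    linear_combination hx
  have hsq : s ^ 2 - t ^ 2 = (s - t) ^ 2 := (sub_pow_char (p := 2) s t).symm
  have h2 : (s - t) * y = algebraMap (ZMod 2) F (c + b) := by
    have h3 : (s - t) * ((s - t) * y + algebraMap (ZMod 2) F (c + b)) = 0 := by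
      rw [hsq] at h1
      linear_combination h1
    have h4 := (mul_eq_zero.1 h3).resolve_left hst'
    rw [← sub_eq_zero, CharTwo.sub_eq_add, h4]
  -- Taking traces in `h2`: the left side has trace `0` by `hc`, and in odd degree a scalar is its
  -- own trace.
  have h3 : c + b = 0 := by
    have h4 := congrArg (Algebra.trace (ZMod 2) F) h2
    rw [Algebra.trace_algebraMap, sub_mul, map_sub, hc, sub_self, nsmul_eq_mul,
      (ZMod.natCast_eq_one_iff_odd).2 hodd, one_mul] at h4
    exact h4.symm
  have hy : y = 0 := by
    rw [h3, map_zero] at h2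
    exact (mul_eq_zero.1 h2).resolve_left hst'
  have hb : b = 0 := by
    have : c = 0 := by simp [c, hy]
    rwa [this, zero_add] at h3
  rw [hy, hb]
  rfl

end Kerdock

theorem exists_isMUB_real {a : ℕ} (ha : 1 ≤ a) :
    ∃ B : Fin (4 ^ a / 2 + 1) → OrthonormalBasis (Fin (4 ^ a)) ℝ (EuclideanSpace ℝ (Fin (4 ^ a))),
      IsMUB B := by
  obtain ⟨n, rfl⟩ : ∃ n, a = n + 1 := ⟨a - 1, by lia⟩
  -- The degree is odd, `F × ZMod 2` has `4 ^ (n + 1)` elements, and `F` supplies the `m / 2` forms.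
  let F := GaloisField 2 (2 * n + 1)
  have : Fintype F := Fintype.ofFinite F
  have hn : 2 * n + 1 ≠ 0 := by lia
  have hcard : Fintype.card F = 2 ^ (2 * n + 1) := by
    rw [← Nat.card_eq_fintype_card]
    exact GaloisField.card 2 _ hn
  have hpow : 4 ^ (n + 1) = 2 ^ (2 * n + 1) * 2 := by
    rw [← pow_succ, show 4 = 2 ^ 2 by norm_num, ← pow_mul]
    ring_nf
  have hV : Fintype.card (F × ZMod 2) = 4 ^ (n + 1) := by
    rw [Fintype.card_prod, hcard, ZMod.card, hpow]
  have hodd : Odd (Module.finrank (ZMod 2) F) := by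
    rw [GaloisField.finrank 2 hn]
    exact odd_two_mul_add_one n
  let e : AddChar (ZMod 2) ℝ := AddChar.zmodChar 2 (ζ := -1) (by norm_num)
  have he : ∀ c, e c = 1 → c = 0 := by
    intro c hc
    have h01 : ∀ c : ZMod 2, c = 0 ∨ c = 1 := by decide
    refine (h01 c).resolve_right ?_
    rintro rfl
    rw [AddChar.zmodChar_apply, ZMod.val_one] at hc
    norm_num at hc
  have hχ : ∀ s : F, ∃ χ : F × ZMod 2 → ℝ, (∀ x, ‖χ x‖ = 1) ∧
      ∀ x y, χ (x + y) = χ x * χ y * e (kerdockForm F s x y) := fun s =>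
    exists_refinement_of_lines e _ (kerdockForm_symm s) (fun _ _ => 1) (by simp)
      (by simp [kerdockForm_self])
  choose χ hχ1 hχ2 using hχ
  let D : LinearMap.BilinForm (ZMod 2) (F × ZMod 2) :=
    (Algebra.traceForm (ZMod 2) F).comp (LinearMap.fst _ _ _) (LinearMap.fst _ _ _) +
      (LinearMap.mul (ZMod 2) (ZMod 2)).compl₁₂ (LinearMap.snd _ _ _) (LinearMap.snd _ _ _)
  have hD : ∀ v, (∀ w, D v w = 0) → v = 0 := by
    rintro ⟨y, b⟩ h
    have h1 : y = 0 := eq_zero_of_forall_trace_mul (p := 2) fun x => by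
      simpa [D, Algebra.traceForm_apply] using h (x, 0)
    have h2 : b = 0 := by
      simpa [D, Algebra.traceForm_apply] using h (0, 1)
    rw [h1, h2]
    rfl
  obtain ⟨B, hB⟩ := exists_isMUB_of_refinement hV he hD hχ1 hχ2
    fun s t hst => eq_zero_of_kerdockForm_eq hodd hst
  let σ : Fin (4 ^ (n + 1) / 2 + 1) ≃ Option F := Fintype.equivOfCardEq (by
    rw [Fintype.card_fin, Fintype.card_option, hcard, hpow, Nat.mul_div_cancel _ two_pos])
  exact ⟨B ∘ σ, fun k k' hk => hB _ _ (σ.injective.ne hk)⟩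

end Maximal

end MixedPacking

end

-- The theorem: size of the family against the dimension

theorem corollary6 (m : ℕ) :
    -- the real case: `m` is a power of `4`
    ((∃ a : ℕ, 1 ≤ a ∧ m = 4 ^ a) →
      (∃ B : Fin (m / 2 + 1) → OrthonormalBasis (Fin m) ℝ (EuclideanSpace ℝ (Fin m)),
        MixedPacking.IsMUB B) ∧
      ∀ (l lam : ℕ) (S : Finset (Finset (Fin m))), MixedPacking.IsSymmetricDesign l lam S →
        ∀ B : Fin (m / 2 + 1) → OrthonormalBasis (Fin m) ℝ (EuclideanSpace ℝ (Fin m)),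
          MixedPacking.IsMUB B →
          ∀ A₁ A₂ : Finset (Fin (m / 2 + 1)), MixedPacking.IsTwoPartition A₁ A₂ →
            MixedPacking.IsTightOptimalMixedPacking
              (MixedPacking.unionFamily B A₁ A₂ S (MixedPacking.complDesign S)) 2) ∧
    -- the complex case: `m` is a prime power
    (IsPrimePow m →
      (∃ B : Fin (m + 1) → OrthonormalBasis (Fin m) ℂ (EuclideanSpace ℂ (Fin m)),
        MixedPacking.IsMUB B) ∧
      -- for `m = 2` the only symmetric design `{{1}, {2}}` is its own complement
      (m ≠ 2 →
        ∀ (l lam : ℕ) (S : Finset (Finset (Fin m))), MixedPacking.IsSymmetricDesign l lam S →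
          ∀ B : Fin (m + 1) → OrthonormalBasis (Fin m) ℂ (EuclideanSpace ℂ (Fin m)),
            MixedPacking.IsMUB B →
            ∀ A₁ A₂ : Finset (Fin (m + 1)), MixedPacking.IsTwoPartition A₁ A₂ →
              MixedPacking.IsTightOptimalMixedPacking
                (MixedPacking.unionFamily B A₁ A₂ S (MixedPacking.complDesign S)) 2)) := by
  refine ⟨?_, fun hm => ⟨MixedPacking.exists_isMUB_complex hm,
    fun hm2 l lam S hS B hB A₁ A₂ hA => ?_⟩⟩
  · rintro ⟨a, ha, rfl⟩
    refine ⟨MixedPacking.exists_isMUB_real ha, fun l lam S hS B hB A₁ A₂ hA => ?_⟩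
    have hm4 : 4 ≤ 4 ^ a := Nat.le_self_pow (by lia) 4
    obtain ⟨n, hn⟩ : 2 ∣ 4 ^ a := dvd_pow (by norm_num) (by lia)
    refine MixedPacking.isTightOptimalMixedPacking_unionFamily (MixedPacking.symmetricOf _)
      (fun A => MixedPacking.mem_range_symmetricOf) ?_ (by lia) hS hB hA
    -- With `m = 2n` the claim is `(2n + 1) n + 1 < (n + 1)(2n)`, that is `1 < n`, true since `4 ≤
    -- m`.
    rw [Module.finrank_fintype_fun_eq_card, Sym2.card, Fintype.card_fin, Fintype.card_fin, hn,
      Nat.choose_two_right, Nat.add_sub_cancel, Nat.mul_div_cancel_left _ two_pos,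
      show (2 * n + 1) * (2 * n) = 2 * ((2 * n + 1) * n) by ring,
      Nat.mul_div_cancel_left _ two_pos]
    nlinarith
  · have hm3 : 2 < m := lt_of_le_of_ne hm.two_le hm2.symm
    refine MixedPacking.isTightOptimalMixedPacking_unionFamily (MixedPacking.hermitianOf _)
      (fun A => MixedPacking.mem_range_hermitianOf) ?_ hm3 hS hB hA
    -- The claim is `m * m + 1 < (m + 1) * m`.
    rw [Module.finrank_fintype_fun_eq_card, Fintype.card_prod, Fintype.card_fin, Fintype.card_fin]
    nlinarith
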